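/- Let $A\in\mathbb R^{n\times n}$ be symmetric positive semidefinite, $b,c\in\mathbb R^n$, let $J_0,J_-,J_+$ be a partition of $\{1,\dots,n\}$ (parts may be empty), $q(x)=\tfrac12x^TAx-b^Tx+c^Tx$, $$\Omega=\{x: x_j=0\ (j\in J_0),\ x_j\le 0\ (j\in J_-),\ x_j\ge 0\ (j\in J_+)\},\qquad \mathcal H=\{x: x_j=0\ (j\in J_0)\},$$ and let $P_{\mathcal H}$ be the Euclidean projection onto $\mathcal H$. Given $x^0\in\Omega$ and $\varepsilon\ge 0$, the truncated projected conjugate gradient method TPCG1 sets $r^0=Ax^0-b+c$, $p^0=P_{\mathcal H}(r^0)$, $d^0=-p^0$, and for $k=0,1,2,\dots$ performs the following iteration: 1. $\alpha_k=\min\{\alpha_k^{cg},\alpha_k^{tc}\}$, where $\alpha_k^{cg}=\|p^k\|^2/((d^k)^TAd^k)$ (with value $\infty$ if $p^k\ne0$ and $(d^k)^TAd^k=0$) and $\alpha_k^{tc}=\max\{\alpha: x^k+\alpha d^k\in\Omega\}$ (with value $\infty$ if this set is unbounded above); 2. $x^{k+1}=x^k+\alpha_kd^k$; 3. if $\alpha_k^{cg}>\alpha_k$,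 return $x^{k+1}$ and terminate; 4. $r^{k+1}=r^k+\alpha_kAd^k$; 5. $p^{k+1}=P_{\mathcal H}(r^{k+1})$; if $\|p^{k+1}\|_\infty\le\varepsilon$, return $x^{k+1}$ and terminate; 6. $d^{k+1}=-p^{k+1}+\frac{\|p^{k+1}\|^2}{\|p^k\|^2}d^k$. Let $B$ be the principal submatrix of $A$ indexed by the complement of $J_0$, and, if $B\neq0$, let $\kappa(B)$ be the ratio of its largest eigenvalue to its smallest positive eigenvalue. **Theorem.** Assume that $\min\{q(x):x\in\Omega\}$ is attained, that $x^0\in\Omega$ and that $\varepsilon\ge0$. (i) If $q$ is bounded below on $\mathcal H$ and $p^0\neq0$ (so that necessarily $B\ne0$), then TPCG1 is well defined and terminates after at most $\min(\max(M,1),\operatorname{rank}B)$ iterations, where $$M=\left\lceil\frac{\log\varepsilon-\log\bigl(2\sqrt{\kappa(B)}\,\|p^0\|\bigr)}{\log(\kappa(B)-1)-\log(\kappa(B)+1)}\right\rceil,$$ with $\|\cdot\|$ the Euclidean norm and the convention $\log0=-\infty$; that is, $M=+\infty$ if $\varepsilon=0$ (so the bound is then $\operatorname{rank}B$), and $M=0$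 if $\varepsilon>0$ and $\kappa(B)=1$. (ii) If $q$ is unbounded below on $\mathcal H$, then TPCG1 is well defined and terminates after at most $\operatorname{rank}(B)+1$ iterations. Here the number of iterations is the number of passes through steps 1-6, the last (terminating) pass included. -/

import Mathlib

noncomputable section

namespace TPCG

/-- The Euclidean norm of a vector in `ℝⁿ`. The type `Fin n → ℝ` itself carries the sup norm, so below
`‖v‖` is the max norm of `v`, while `l2norm v` is its Euclidean norm. -/
def l2norm {n : ℕ} (v : Fin n → ℝ) : ℝ := ‖WithLp.toLp 2 v‖

/-- The data of a quadratic program over a face of an orthant of `ℝⁿ`. -/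
structure FaceQP (n : ℕ) where
  A : Matrix (Fin n) (Fin n) ℝ
  b : Fin n → ℝ
  c : Fin n → ℝ
  J0 : Finset (Fin n)
  Jneg : Finset (Fin n)
  Jpos : Finset (Fin n)

namespace FaceQP

variable {n : ℕ} (P : FaceQP n)

/-- `J0`, `Jneg`, `Jpos` form a partition of the index set (empty parts are allowed). -/
def IsPartition : Prop :=
  Disjoint P.J0 P.Jneg ∧ Disjoint P.J0 P.Jpos ∧ Disjoint P.Jneg P.Jpos ∧
    P.J0 ∪ P.Jneg ∪ P.Jpos = Finset.univ

/-- The objective `q(x) = ½ xᵀAx - bᵀx + cᵀx`. -/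
def q (x : Fin n → ℝ) : ℝ :=
  1 / 2 * (x ⬝ᵥ (P.A.mulVec x)) - P.b ⬝ᵥ x + P.c ⬝ᵥ x

/-- The feasible region of the face-constrained problem. -/
def Ω : Set (Fin n → ℝ) :=
  {x | (∀ j ∈ P.J0, x j = 0) ∧ (∀ j ∈ P.Jneg, x j ≤ 0) ∧ (∀ j ∈ P.Jpos, 0 ≤ x j)}

/-- The feasible region (a subspace) of the equality-constrained problem. -/
def H : Set (Fin n → ℝ) := {x | ∀ j ∈ P.J0, x j = 0}

/-- The face-constrained problem `min {q x : x ∈ Ω}` has an optimal solution. -/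
def HasSolution : Prop := ∃ x ∈ P.Ω, ∀ y ∈ P.Ω, P.q x ≤ P.q y

/-- The equality-constrained problem `min {q x : x ∈ H}` is bounded below. -/
def EqBddBelow : Prop := BddBelow (P.q '' P.H)

/-- The Euclidean projection onto `H`: put the coordinates in `J0` to zero. -/
def proj (r : Fin n → ℝ) : Fin n → ℝ := fun j => if j ∈ P.J0 then 0 else r j

theorem proj_mem (r : Fin n → ℝ) : P.proj r ∈ P.H := by
  intro j hj
  simp [proj, hj]

/-- `proj r` is the point of `H` nearest to `r`. -/
theorem proj_nearest (r y : Fin n → ℝ) (hy : y ∈ P.H) :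
    l2norm (r - P.proj r) ≤ l2norm (r - y) := by
  unfold l2norm
  rw [EuclideanSpace.norm_eq, EuclideanSpace.norm_eq]
  apply Real.sqrt_le_sqrt
  apply Finset.sum_le_sum
  intro j _
  by_cases hj : j ∈ P.J0
  · simp [proj, hj, hy j hj]
  · simp [proj, hj]
    positivity

/-- The principal submatrix of `A` indexed by the complement of `J0`. -/
def B : Matrix {j : Fin n // j ∉ P.J0} {j : Fin n // j ∉ P.J0} ℝ :=
  P.A.submatrix Subtype.val Subtype.val

/-- `αᶜᵍ = ‖p‖² / dᵀAd`, read as `∞` when `p ≠ 0` and `dᵀAd = 0`. (It is used only for `p ≠ 0`.) -/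
def alphaCG (p d : Fin n → ℝ) : EReal :=
  open Classical in
  if d ⬝ᵥ (P.A.mulVec d) = 0 then ⊤
  else ((l2norm p ^ 2 / (d ⬝ᵥ (P.A.mulVec d)) : ℝ) : EReal)

/-- `αᵗᶜ = max {α : x + α d ∈ Ω}`, which is `∞` when this set of reals is unbounded above. When it is
nonempty and bounded above, the supremum is attained because `Ω` is closed. -/
def alphaTC (x d : Fin n → ℝ) : EReal :=
  sSup ((fun α : ℝ => (α : EReal)) '' {α : ℝ | x + α • d ∈ P.Ω})

/-- The step length `α = min {αᶜᵍ, αᵗᶜ}`. -/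
def alpha (x p d : Fin n → ℝ) : EReal := min (P.alphaCG p d) (P.alphaTC x d)

end FaceQP

/-- The current iterate `(xᵏ, rᵏ, pᵏ, dᵏ)` of the method. -/
structure State (n : ℕ) where
  x : Fin n → ℝ
  r : Fin n → ℝ
  p : Fin n → ℝ
  d : Fin n → ℝ

/-- The possible outcomes of one pass through the loop: the pass runs into an undefined operation,
the method returns `y` and stops, or it goes on with a new iterate. -/
inductive Outcome (n : ℕ) where
  | undefined : Outcome n
  | done (y : Fin n → ℝ) : Outcome n
  | next (s : State n) : Outcome n

namespace FaceQP

variable {n : ℕ} (P : FaceQP n)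

/-- Initialization: `r⁰ = A x⁰ - b + c`, `p⁰ = proj r⁰`, `d⁰ = -p⁰`. -/
def init (x0 : Fin n → ℝ) : State n where
  x := x0
  r := P.A.mulVec x0 - P.b + P.c
  p := P.proj (P.A.mulVec x0 - P.b + P.c)
  d := -P.proj (P.A.mulVec x0 - P.b + P.c)

/-- One pass through the loop of the truncated projected CG method with tolerance `ε`. The pass is
undefined if `p = 0` (then `αᶜᵍ = 0/0`) or if the step length is not a real number. -/
def pass (ε : ℝ) (s : State n) : Outcome n :=
  open Classical in
  let α := P.alpha s.x s.p s.d
  if s.p = 0 ∨ α = ⊤ ∨ α = ⊥ then Outcome.undefined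
  else
    let x' := s.x + α.toReal • s.d
    if α < P.alphaCG s.p s.d then Outcome.done x'
    else
      let r' := s.r + α.toReal • P.A.mulVec s.d
      let p' := P.proj r'
      if ‖p'‖ ≤ ε then Outcome.done x'
      else Outcome.next
        { x := x', r := r', p := p', d := -p' + (l2norm p' ^ 2 / l2norm s.p ^ 2) • s.d }

/-- `P.Returns ε s N y`: started from `s`, the loop is executed exactly `N` times (every pass being
well defined), and the `N`-th pass returns `y`. -/
inductive Returns (ε : ℝ) : State n → ℕ → (Fin n → ℝ) → Prop where
  | done {s : State n} {y : Fin n → ℝ} :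
      P.pass ε s = Outcome.done y → Returns ε s 1 y
  | next {s s' : State n} {N : ℕ} {y : Fin n → ℝ} :
      P.pass ε s = Outcome.next s' → Returns ε s' N y → Returns ε s (N + 1) y

end FaceQP

/-- The generalized condition number of a nonzero symmetric positive semidefinite matrix: its largest
eigenvalue divided by its smallest positive eigenvalue. -/
def kappa {ι : Type} [Fintype ι] [DecidableEq ι] (M : Matrix ι ι ℝ) : ℝ :=
  sSup (spectrum ℝ M) / sInf {μ : ℝ | μ ∈ spectrum ℝ M ∧ 0 < μ}

/-- The bound `M = ⌈(log ε - log (2 √κ ρ)) / (log (κ - 1) - log (κ + 1))⌉` with the convention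
`log 0 = -∞`: it is `+∞` if `ε = 0`, and `0` if `ε > 0` and `κ = 1`. -/
def bigM (ε κ ρ : ℝ) : WithTop ℤ :=
  open Classical in
  if ε = 0 then ⊤
  else if κ = 1 then 0
  else ((⌈(Real.log ε - Real.log (2 * √κ * ρ)) /
    (Real.log (κ - 1) - Real.log (κ + 1))⌉ : ℤ) : WithTop ℤ)

end TPCG

end

/-! Restricted to the free coordinates, every pass that does not stop is a step of the plain
conjugate gradient method for `P.B` (`FullSteps.isCGRun`). It remains to bound the number `m` of
such steps; the run then takes `m + 1` passes.

Rank bound: the nonzero gradients are pairwise orthogonal and lie in any space containing the first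
gradient and the range of `P.B`. If `q` is bounded below on `H`, that range contains the first
gradient; otherwise one extra dimension suffices (`length_lt_finrank`).

Logarithmic bound: each step reduces the energy of the error at least as much as steepest descent,
so the Kantorovich inequality yields the factor `((κ - 1) / (κ + 1)) ^ 2`. Passing between energy
and gradient norm costs `κ` (`norm_sq_g_le`).

No pass is undefined: an infinite step would mean a feasible descent ray of zero curvature, along
which `q` would tend to `-∞` on `Ω`. -/

section ConjugateGradient

/-! ### Conjugate gradients for a symmetric operator -/

variable {E : Type*} [NormedAddCommGroup E] [InnerProductSpace ℝ E]

/-- The gradients `g` and directions `v` of `m` steps of the conjugate gradient method for the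
operator `T`, none of which breaks down. -/
structure IsCGRun (T : E →ₗ[ℝ] E) (g v : ℕ → E) (m : ℕ) : Prop where
  v_zero : v 0 = -g 0
  g_succ : ∀ k < m, g (k + 1) = g k + (‖g k‖ ^ 2 / inner ℝ (v k) (T (v k))) • T (v k)
  v_succ : ∀ k < m, v (k + 1) = -g (k + 1) + (‖g (k + 1)‖ ^ 2 / ‖g k‖ ^ 2) • v k
  g_ne_zero : ∀ k < m, g k ≠ 0
  curvature_ne_zero : ∀ k < m, inner ℝ (v k) (T (v k)) ≠ 0

namespace IsCGRun

variable {T : E →ₗ[ℝ] E} {g v : ℕ → E} {m : ℕ}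

/-- The exact line search makes each direction orthogonal to the next gradient, so only the `-g`
part of the new direction contributes. -/
theorem inner_v_g (h : IsCGRun T g v m) {k : ℕ} (hk : k ≤ m) :
    inner ℝ (v k) (g k) = -‖g k‖ ^ 2 := by
  induction k with
  | zero => rw [h.v_zero, inner_neg_left, real_inner_self_eq_norm_sq]
  | succ k ih =>
    have hk' : k < m := hk
    have h0 : inner ℝ (v k) (g (k + 1)) = 0 := by
      rw [h.g_succ k hk', inner_add_right, inner_smul_right, ih hk'.le,
        div_mul_cancel₀ _ (h.curvature_ne_zero k hk')]
      ring
    rw [h.v_succ k hk', inner_add_left, inner_neg_left, real_inner_self_eq_norm_sq,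
      real_inner_smul_left, h0]
    ring

/-- Both properties are proved in one induction: `T (v j)` is a multiple of `g (j + 1) - g j`, and
each gradient combines two consecutive directions, so each property feeds the other. -/
theorem orthogonal_and_conjugate (hT : T.IsSymmetric) (h : IsCGRun T g v m) {k : ℕ} (hk : k ≤ m) :
    ∀ j < k, inner ℝ (g k) (g j) = 0 ∧ inner ℝ (v k) (T (v j)) = 0 := by
  induction k with
  | zero => intro j hj; omega
  | succ k ih =>
    have hk' : k < m := hk
    have ih := ih hk'.le
    set a := ‖g k‖ ^ 2 / inner ℝ (v k) (T (v k)) with ha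
    have hak : a * inner ℝ (v k) (T (v k)) = ‖g k‖ ^ 2 :=
      div_mul_cancel₀ _ (h.curvature_ne_zero k hk')
    have hTv (j : ℕ) (hj : j ≤ k) : inner ℝ (T (v k)) (g j) = -inner ℝ (v k) (T (v j)) := by
      rcases j with _ | j
      · rw [h.v_zero, map_neg, inner_neg_right, neg_neg, hT]
      · have hg : g (j + 1) = -v (j + 1) + (‖g (j + 1)‖ ^ 2 / ‖g j‖ ^ 2) • v j := by
          rw [h.v_succ j (by omega)]; abel
        rw [hg, inner_add_right, inner_neg_right, inner_smul_right, hT, hT, (ih j (by omega)).2]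
        ring
    have horth (j : ℕ) (hj : j ≤ k) : inner ℝ (g (k + 1)) (g j) = 0 := by
      rw [h.g_succ k hk', inner_add_left, real_inner_smul_left, ← ha, hTv j hj]
      rcases hj.lt_or_eq with hlt | rfl
      · rw [(ih j hlt).1, (ih j hlt).2]; ring
      · rw [real_inner_self_eq_norm_sq, mul_neg, hak]; ring
    intro j hj
    have hjk : j ≤ k := by omega
    refine ⟨horth j hjk, ?_⟩
    have hgj := norm_ne_zero_iff.2 (h.g_ne_zero j (by omega))
    have hcj := h.curvature_ne_zero j (by omega)
    -- For `j < k` this forces the product with `T (v j)` to vanish; for `j = k` it gives the value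
    -- that the coefficient of `v k` cancels.
    have hTj : inner ℝ (g (k + 1)) (g (j + 1)) =
        (‖g j‖ ^ 2 / inner ℝ (v j) (T (v j))) * inner ℝ (g (k + 1)) (T (v j)) := by
      rw [h.g_succ j (by omega), inner_add_right, inner_smul_right, horth j hjk, zero_add]
    rw [h.v_succ k hk', inner_add_left, inner_neg_left, real_inner_smul_left]
    rcases hjk.lt_or_eq with hlt | rfl
    · rw [horth (j + 1) (by omega)] at hTj
      rw [(ih j hlt).2]
      have := (mul_eq_zero.1 hTj.symm).resolve_left (div_ne_zero (pow_ne_zero 2 hgj) hcj)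
      rw [this]; ring
    · rw [real_inner_self_eq_norm_sq] at hTj
      rw [hTj]
      field_simp
      ring

theorem inner_g_eq_zero (hT : T.IsSymmetric) (h : IsCGRun T g v m) {i j : ℕ} (hi : i ≤ m)
    (hj : j ≤ m) (hij : i ≠ j) : inner ℝ (g i) (g j) = 0 := by
  rcases hij.lt_or_gt with hlt | hlt
  · rw [real_inner_comm]; exact (h.orthogonal_and_conjugate hT hj i hlt).1
  · exact (h.orthogonal_and_conjugate hT hi j hlt).1

theorem g_mem (h : IsCGRun T g v m) {V : Submodule ℝ E} (hV : LinearMap.range T ≤ V)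
    (h0 : g 0 ∈ V) {k : ℕ} (hk : k ≤ m) : g k ∈ V := by
  induction k with
  | zero => exact h0
  | succ k ih =>
    rw [h.g_succ k hk]
    exact V.add_mem (ih (by omega)) (V.smul_mem _ (hV ⟨_, rfl⟩))

/-- The gradients of a run whose last gradient does not vanish are linearly independent. -/
theorem length_lt_finrank (hT : T.IsSymmetric) (h : IsCGRun T g v m) (hm : g m ≠ 0)
    {V : Submodule ℝ E} [FiniteDimensional ℝ V] (hV : LinearMap.range T ≤ V) (h0 : g 0 ∈ V) :
    m + 1 ≤ Module.finrank ℝ V := by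
  let w : Fin (m + 1) → V := fun i => ⟨g i, h.g_mem hV h0 (by omega)⟩
  have hw : LinearIndependent ℝ w := by
    apply linearIndependent_of_ne_zero_of_inner_eq_zero
    · intro i hi
      have hi' : g i = 0 := congrArg Subtype.val hi
      rcases (show (i : ℕ) ≤ m by omega).lt_or_eq with hlt | heq
      · exact h.g_ne_zero i hlt hi'
      · exact hm (heq ▸ hi')
    · intro i j hij
      exact h.inner_g_eq_zero hT (by omega) (by omega) (fun hv => hij (Fin.ext hv))
  simpa using hw.fintype_card_le_finrank

/-- One step of the method decreases the energy at least as much as a steepest descent step. -/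
theorem curvature_v_le (hT : T.IsSymmetric) (hpos : ∀ x, 0 ≤ inner ℝ x (T x))
    (h : IsCGRun T g v m) {k : ℕ} (hk : k ≤ m) :
    inner ℝ (v k) (T (v k)) ≤ inner ℝ (g k) (T (g k)) := by
  rcases k with _ | k
  · rw [h.v_zero, map_neg, inner_neg_neg]
  · have hg : g (k + 1) = -v (k + 1) + (‖g (k + 1)‖ ^ 2 / ‖g k‖ ^ 2) • v k := by
      rw [h.v_succ k hk]; abel
    set β := ‖g (k + 1)‖ ^ 2 / ‖g k‖ ^ 2
    have hc := (h.orthogonal_and_conjugate hT hk k (by omega)).2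
    have hc' : inner ℝ (v k) (T (v (k + 1))) = 0 := by rw [← hT, real_inner_comm, hc]
    -- By conjugacy the cross terms drop out, and the two curvatures differ by `β ^ 2` times that of
    -- `v k`.
    rw [hg]
    simp only [map_add, map_neg, map_smul, inner_add_left, inner_add_right, inner_neg_left,
      inner_neg_right, real_inner_smul_left, inner_smul_right, hc, hc']
    nlinarith [mul_nonneg (mul_self_nonneg β) (hpos (v k))]

/-- Linear convergence of the method for a system in the range of an operator whose spectrum lies
in `{0} ∪ [l, L]`. -/
theorem norm_sq_g_le (hT : T.IsSymmetric) (hpos : ∀ x, 0 ≤ inner ℝ x (T x))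
    (h : IsCGRun T g v m) (h0 : g 0 ∈ LinearMap.range T) {l L : ℝ} (hl : 0 < l) (hlL : l ≤ L)
    (hL : ∀ x, ‖T x‖ ^ 2 ≤ L * inner ℝ x (T x)) (hl' : ∀ x, l * inner ℝ x (T x) ≤ ‖T x‖ ^ 2)
    (hlL' : ∀ x, inner ℝ (T x) (T (T x)) + l * L * inner ℝ x (T x) ≤ (l + L) * ‖T x‖ ^ 2)
    {k : ℕ} (hk : k ≤ m) :
    ‖g k‖ ^ 2 ≤ L / l * (((L - l) / (L + l)) ^ 2) ^ k * ‖g 0‖ ^ 2 := by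
  obtain ⟨e0, he0⟩ := h0
  have hsum : 0 < L + l := by linarith
  -- `e` plays the role of the error of the iterate, and `inner ℝ e (T e)` is its energy.
  have key : ∃ e, T e = g k ∧
      inner ℝ e (T e) ≤ (((L - l) / (L + l)) ^ 2) ^ k * inner ℝ e0 (T e0) := by
    induction k with
    | zero => exact ⟨e0, he0, by simp⟩
    | succ k ih =>
      have hk' : k < m := hk
      obtain ⟨e, he, hle⟩ := ih hk'.le
      set s := inner ℝ (v k) (T (v k)) with hs
      have hs0 : 0 < s := lt_of_le_of_ne (hpos _) (h.curvature_ne_zero k hk').symm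
      have hsg : s ≤ inner ℝ (g k) (T (g k)) := h.curvature_v_le hT hpos hk'.le
      have hK := hlL' e
      rw [he] at hK hle
      refine ⟨e + (‖g k‖ ^ 2 / s) • v k, by rw [map_add, map_smul, he, h.g_succ k hk'], ?_⟩
      have hφ : 0 ≤ inner ℝ e (g k) := by rw [← he]; exact hpos e
      have hvg := h.inner_v_g hk'.le
      have hcross : inner ℝ e (T (v k)) = -‖g k‖ ^ 2 := by
        rw [← hT, he, real_inner_comm, hvg]
      rw [map_add, map_smul, he]
      simp only [inner_add_left, inner_add_right, real_inner_smul_left, inner_smul_right, hcross,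
        hvg, ← hs]
      set G := ‖g k‖ ^ 2
      set φ := inner ℝ e (g k)
      set w := inner ℝ (g k) (T (g k))
      -- Kantorovich inequality: AM-GM applied to `w` and `l * L * φ`, whose sum `hK` bounds, with
      -- `s ≤ w`.
      have hG : 4 * (l * L) * φ * s ≤ (L + l) ^ 2 * G ^ 2 := by
        have h1 : 4 * (w * (l * L * φ)) ≤ (w + l * L * φ) ^ 2 := by
          nlinarith [sq_nonneg (w - l * L * φ)]
        have hw : 0 ≤ w := hs0.le.trans hsg
        have hp : 0 ≤ l * L * φ := by have := hl.le.trans hlL; positivity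
        have h2 : (w + l * L * φ) ^ 2 ≤ ((l + L) * G) ^ 2 :=
          pow_le_pow_left₀ (by positivity) hK 2
        nlinarith [mul_le_mul_of_nonneg_right hsg hp]
      have hstep : φ - G ^ 2 / s ≤ ((L - l) / (L + l)) ^ 2 * φ := by
        have h3 : 4 * (l * L) / (L + l) ^ 2 * φ ≤ G ^ 2 / s := by
          rw [le_div_iff₀ hs0, div_mul_eq_mul_div, div_mul_eq_mul_div, div_le_iff₀ (by positivity)]
          linarith
        have h4 : ((L - l) / (L + l)) ^ 2 = 1 - 4 * (l * L) / (L + l) ^ 2 := by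
          field_simp; ring
        rw [h4]; linarith
      calc φ + G / s * -G + G / s * (-G + G / s * s) = φ - G ^ 2 / s := by field_simp; ring
        _ ≤ ((L - l) / (L + l)) ^ 2 * φ := hstep
        _ ≤ ((L - l) / (L + l)) ^ 2 * ((((L - l) / (L + l)) ^ 2) ^ k * inner ℝ e0 (T e0)) := by
          gcongr
        _ = _ := by ring
  obtain ⟨e, he, hle⟩ := key
  have h1 := hL e
  have h2 := hl' e0
  rw [he] at h1
  rw [he0] at h2 hle
  have hLpos : 0 < L := hl.trans_le hlL
  have h3 : inner ℝ e0 (g 0) ≤ ‖g 0‖ ^ 2 / l := by rw [le_div_iff₀ hl]; linarith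
  calc ‖g k‖ ^ 2 ≤ L * inner ℝ e (g k) := h1
    _ ≤ L * ((((L - l) / (L + l)) ^ 2) ^ k * inner ℝ e0 (g 0)) := by
      rw [he] at hle; gcongr
    _ ≤ L * ((((L - l) / (L + l)) ^ 2) ^ k * (‖g 0‖ ^ 2 / l)) := by gcongr
    _ = _ := by ring

end IsCGRun

end ConjugateGradient

/-! ### Eigenvalue bounds and the iteration count -/

section Spectrum

variable {ι : Type} [Fintype ι] [DecidableEq ι] {M : Matrix ι ι ℝ}

theorem Matrix.rank_eq_finrank_range_toEuclideanLin (M : Matrix ι ι ℝ) :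
    M.rank = Module.finrank ℝ (LinearMap.range (Matrix.toEuclideanLin M)) := by
  rw [M.rank_eq_finrank_range_toLin (EuclideanSpace.basisFun ι ℝ).toBasis
    (EuclideanSpace.basisFun ι ℝ).toBasis, Matrix.toEuclideanLin_eq_toLin_orthonormal]

theorem Matrix.IsHermitian.inner_eigenvectorBasis_toEuclideanLin (hM : M.IsHermitian) (i : ι)
    (x : EuclideanSpace ℝ ι) :
    inner ℝ (hM.eigenvectorBasis i) (Matrix.toEuclideanLin M x) =
      hM.eigenvalues i * inner ℝ (hM.eigenvectorBasis i) x := by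
  have hu : Matrix.toEuclideanLin M (hM.eigenvectorBasis i) =
      hM.eigenvalues i • hM.eigenvectorBasis i := by
    apply (WithLp.linearEquiv 2 ℝ (ι → ℝ)).injective
    simpa using hM.mulVec_eigenvectorBasis i
  rw [← (Matrix.isSymmetric_toEuclideanLin_iff.2 hM), hu, real_inner_smul_left]

/-- In these coordinates the operator inequalities required by `norm_sq_g_le` become scalar ones,
checked at each eigenvalue. -/
theorem Matrix.IsHermitian.inner_toEuclideanLin_eq_sum (hM : M.IsHermitian)
    (x : EuclideanSpace ℝ ι) :
    inner ℝ x (Matrix.toEuclideanLin M x) =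
        ∑ i, hM.eigenvalues i * inner ℝ (hM.eigenvectorBasis i) x ^ 2 ∧
      ‖Matrix.toEuclideanLin M x‖ ^ 2 =
        ∑ i, hM.eigenvalues i ^ 2 * inner ℝ (hM.eigenvectorBasis i) x ^ 2 ∧
      inner ℝ (Matrix.toEuclideanLin M x)
          (Matrix.toEuclideanLin M (Matrix.toEuclideanLin M x)) =
        ∑ i, hM.eigenvalues i ^ 3 * inner ℝ (hM.eigenvectorBasis i) x ^ 2 := by
  have hsum (y z : EuclideanSpace ℝ ι) : inner ℝ y z =
      ∑ i, inner ℝ (hM.eigenvectorBasis i) y * inner ℝ (hM.eigenvectorBasis i) z := by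
    rw [← hM.eigenvectorBasis.sum_inner_mul_inner y z]
    exact Finset.sum_congr rfl fun i _ => by rw [real_inner_comm]
  rw [← real_inner_self_eq_norm_sq]
  refine ⟨?_, ?_, ?_⟩ <;> rw [hsum] <;> refine Finset.sum_congr rfl fun i _ => ?_ <;>
    simp only [hM.inner_eigenvectorBasis_toEuclideanLin] <;> ring

theorem Matrix.PosSemidef.inner_toEuclideanLin_nonneg (hM : M.PosSemidef)
    (x : EuclideanSpace ℝ ι) : 0 ≤ inner ℝ x (Matrix.toEuclideanLin M x) := by
  rw [(hM.isHermitian.inner_toEuclideanLin_eq_sum x).1]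
  exact Finset.sum_nonneg fun i _ => mul_nonneg (hM.eigenvalues_nonneg i) (sq_nonneg _)

/-- The extreme positive eigenvalues of a nonzero positive semidefinite matrix. -/
theorem Matrix.PosSemidef.exists_eigenvalue_bounds (hM : M.PosSemidef) (h0 : M ≠ 0) :
    ∃ l L : ℝ, 0 < l ∧ l ≤ L ∧ TPCG.kappa M = L / l ∧
      ∀ i, hM.isHermitian.eigenvalues i = 0 ∨
        l ≤ hM.isHermitian.eigenvalues i ∧ hM.isHermitian.eigenvalues i ≤ L := by
  have hfin : (spectrum ℝ M).Finite := M.finite_real_spectrum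
  set S := {μ : ℝ | μ ∈ spectrum ℝ M ∧ 0 < μ} with hS
  have hSfin : S.Finite := hfin.subset fun μ h => h.1
  obtain ⟨i, hi⟩ : ∃ i, hM.isHermitian.eigenvalues i ≠ 0 := by
    by_contra! h
    exact h0 (hM.isHermitian.eigenvalues_eq_zero_iff.1 (funext h))
  have hmem (i : ι) := hM.isHermitian.eigenvalues_mem_spectrum_real i
  have hpos (i : ι) (hi : hM.isHermitian.eigenvalues i ≠ 0) : hM.isHermitian.eigenvalues i ∈ S :=
    ⟨hmem i, lt_of_le_of_ne (hM.eigenvalues_nonneg i) hi.symm⟩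
  have hl : sInf S ∈ S := Set.Nonempty.csInf_mem ⟨_, hpos i hi⟩ hSfin
  refine ⟨sInf S, sSup (spectrum ℝ M), hl.2, le_csSup hfin.bddAbove hl.1, rfl, fun j => ?_⟩
  by_cases hj : hM.isHermitian.eigenvalues j = 0
  · exact Or.inl hj
  · exact Or.inr ⟨csInf_le hSfin.bddBelow (hpos j hj), le_csSup hfin.bddAbove (hmem j)⟩

/-- The conjugate gradient method for a consistent positive semidefinite system converges
linearly, at a rate governed by the generalized condition number. -/
theorem IsCGRun.norm_sq_g_le_kappa {g v : ℕ → EuclideanSpace ℝ ι} {m : ℕ}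
    (hM : M.PosSemidef) (h : IsCGRun (Matrix.toEuclideanLin M) g v m)
    (h0 : g 0 ∈ LinearMap.range (Matrix.toEuclideanLin M)) (hg : g 0 ≠ 0) :
    1 ≤ TPCG.kappa M ∧ ∀ k ≤ m, ‖g k‖ ^ 2 ≤
      TPCG.kappa M * (((TPCG.kappa M - 1) / (TPCG.kappa M + 1)) ^ 2) ^ k * ‖g 0‖ ^ 2 := by
  have hM0 : M ≠ 0 := by
    rintro rfl
    obtain ⟨e, he⟩ := h0
    exact hg (by rw [← he, map_zero, LinearMap.zero_apply])
  obtain ⟨l, L, hl, hlL, hκ, heig⟩ := hM.exists_eigenvalue_bounds hM0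
  have hS := hM.isHermitian.inner_toEuclideanLin_eq_sum
  have hL : 0 < L := hl.trans_le hlL
  refine ⟨by rw [hκ, one_le_div hl]; exact hlL, fun k hk => ?_⟩
  have hρ : (TPCG.kappa M - 1) / (TPCG.kappa M + 1) = (L - l) / (L + l) := by
    rw [hκ]; field_simp
  rw [hρ, hκ]
  refine h.norm_sq_g_le (Matrix.isSymmetric_toEuclideanLin_iff.2 hM.isHermitian)
    hM.inner_toEuclideanLin_nonneg h0 hl hlL (fun x => ?_) (fun x => ?_) (fun x => ?_) hk
  · rw [(hS x).1, (hS x).2.1, Finset.mul_sum]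
    refine Finset.sum_le_sum fun i _ => ?_
    rw [← mul_assoc]
    refine mul_le_mul_of_nonneg_right ?_ (sq_nonneg _)
    rcases heig i with h | ⟨h1, h2⟩
    · simp [h]
    · nlinarith
  · rw [(hS x).1, (hS x).2.1, Finset.mul_sum]
    refine Finset.sum_le_sum fun i _ => ?_
    rw [← mul_assoc]
    refine mul_le_mul_of_nonneg_right ?_ (sq_nonneg _)
    rcases heig i with h | ⟨h1, h2⟩
    · simp [h]
    · nlinarith
  -- For each eigenvalue `μ` this is `μ * (μ - l) * (μ - L) ≤ 0`.
  · rw [(hS x).1, (hS x).2.1, (hS x).2.2, Finset.mul_sum, Finset.mul_sum, ← Finset.sum_add_distrib]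
    refine Finset.sum_le_sum fun i _ => ?_
    rw [← mul_assoc, ← mul_assoc, ← add_mul]
    refine mul_le_mul_of_nonneg_right ?_ (sq_nonneg _)
    rcases heig i with h | ⟨h1, h2⟩
    · simp [h]
    · nlinarith [mul_nonneg (hl.le.trans h1) (mul_nonneg (sub_nonneg.2 h1) (sub_nonneg.2 h2))]

theorem TPCG.succ_le_bigM {ε κ G g : ℝ} {m : ℕ} (hε : 0 ≤ ε) (hκ : 1 ≤ κ) (hG : 0 < G)
    (hm : m ≠ 0) (hlt : ε < g) (hg : g ^ 2 ≤ κ * (((κ - 1) / (κ + 1)) ^ 2) ^ m * G ^ 2) :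
    (((m + 1 : ℕ) : ℤ) : WithTop ℤ) ≤ TPCG.bigM ε κ G := by
  unfold TPCG.bigM
  split_ifs with h0 h1
  · exact le_top
  -- For `κ = 1` the rate is zero, so one full step would already give `g = 0`, against `ε < g`.
  · subst h1
    have : (0 : ℝ) < g ^ 2 := by have := hε.trans_lt hlt; positivity
    simp [hm] at hg
    linarith
  · have hε' : 0 < ε := lt_of_le_of_ne hε (Ne.symm h0)
    have hκ' : 0 < κ - 1 := sub_pos.2 (lt_of_le_of_ne hκ (Ne.symm h1))
    have hκ0 : 0 < κ := by linarith
    have hκ1 : 0 < κ + 1 := by linarith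
    set ρ := (κ - 1) / (κ + 1) with hρ
    have hρ0 : 0 < ρ := div_pos hκ' hκ1
    have hgle : g ≤ √κ * ρ ^ m * G := by
      refine (sq_le_sq₀ (hε.trans hlt.le) (by positivity)).1 ?_
      rw [mul_pow, mul_pow, Real.sq_sqrt hκ0.le, pow_right_comm]
      exact hg
    have hlog : Real.log ε < Real.log (√κ) + m * (Real.log (κ - 1) - Real.log (κ + 1)) +
        Real.log G := by
      rw [← Real.log_div hκ'.ne' hκ1.ne', ← Real.log_pow, ← Real.log_mul (by positivity)
        (by positivity), ← Real.log_mul (by positivity) hG.ne']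
      exact Real.log_lt_log hε' (hlt.trans_le hgle)
    rw [WithTop.coe_le_coe]
    push_cast
    -- The denominator is negative, so the inequality flips. The `log 2` from the factor 2 in `bigM`
    -- is pure slack.
    rw [Int.add_one_le_iff, Int.lt_ceil, lt_div_iff_of_neg
      (sub_neg.2 (Real.log_lt_log hκ' (by linarith))), Real.log_mul (by positivity) hG.ne',
      Real.log_mul two_ne_zero (by positivity)]
    have := Real.log_pos (one_lt_two (α := ℝ))
    push_cast
    linarith

end Spectrum

/-! ### The quadratic program on the face and its free coordinates -/

namespace TPCG

namespace FaceQP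

variable {n : ℕ} (P : FaceQP n)

theorem q_add_smul (hA : P.A.PosSemidef) (x d : Fin n → ℝ) (t : ℝ) :
    P.q (x + t • d) = P.q x + t * ((P.A.mulVec x - P.b + P.c) ⬝ᵥ d) +
      t ^ 2 / 2 * (d ⬝ᵥ P.A.mulVec d) := by
  have hs : x ⬝ᵥ P.A.mulVec d = P.A.mulVec x ⬝ᵥ d := by
    rw [Matrix.dotProduct_mulVec, ← Matrix.mulVec_transpose]
    congr 2
    simpa using hA.isHermitian.eq
  have hs' : d ⬝ᵥ P.A.mulVec x = P.A.mulVec x ⬝ᵥ d := dotProduct_comm _ _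
  simp only [q, Matrix.mulVec_add, Matrix.mulVec_smul, dotProduct_add, add_dotProduct,
    sub_dotProduct, smul_dotProduct, dotProduct_smul, smul_eq_mul, hs, hs']
  ring

theorem proj_dotProduct {d : Fin n → ℝ} (hd : d ∈ P.H) (r : Fin n → ℝ) :
    P.proj r ⬝ᵥ d = r ⬝ᵥ d := by
  refine Finset.sum_congr rfl fun j _ => ?_
  by_cases hj : j ∈ P.J0
  · simp [hd j hj]
  · simp [proj, hj]

theorem dotProduct_mulVec_nonneg (hA : P.A.PosSemidef) (d : Fin n → ℝ) :
    0 ≤ d ⬝ᵥ P.A.mulVec d := by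
  simpa using hA.dotProduct_mulVec_nonneg d

theorem Ω_subset_H : P.Ω ⊆ P.H := fun _ hx => hx.1

/-- The restriction of a vector to the free coordinates. -/
def restr : (Fin n → ℝ) →ₗ[ℝ] EuclideanSpace ℝ {j : Fin n // j ∉ P.J0} :=
  (WithLp.linearEquiv 2 ℝ ({j : Fin n // j ∉ P.J0} → ℝ)).symm.toLinearMap ∘ₗ
    LinearMap.funLeft ℝ ℝ Subtype.val

@[simp] theorem restr_apply (x : Fin n → ℝ) (j : {j : Fin n // j ∉ P.J0}) :
    P.restr x j = x j := rfl

theorem sum_free_eq {f : Fin n → ℝ} (hf : ∀ j ∈ P.J0, f j = 0) :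
    ∑ j : {j : Fin n // j ∉ P.J0}, f j = ∑ j, f j := by
  rw [← Fintype.sum_subtype_add_sum_subtype (fun j => j ∈ P.J0) f, eq_comm]
  simp only [add_eq_right]
  exact Finset.sum_eq_zero fun j _ => hf j j.2

theorem inner_restr (u : Fin n → ℝ) {v : Fin n → ℝ} (hv : v ∈ P.H) :
    inner ℝ (P.restr u) (P.restr v) = u ⬝ᵥ v := by
  rw [dotProduct, ← P.sum_free_eq (f := fun j => u j * v j) (fun j hj => by simp [hv j hj]),
    PiLp.inner_apply]
  exact Finset.sum_congr rfl fun j _ => by simp [mul_comm]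

theorem norm_restr {u : Fin n → ℝ} (hu : u ∈ P.H) : ‖P.restr u‖ = l2norm u := by
  rw [l2norm, ← sq_eq_sq₀ (norm_nonneg _) (norm_nonneg _), ← real_inner_self_eq_norm_sq,
    P.inner_restr u hu, EuclideanSpace.real_norm_sq_eq]
  exact Finset.sum_congr rfl fun j _ => (sq (u j)).symm

theorem restr_proj (r : Fin n → ℝ) : P.restr (P.proj r) = P.restr r := by
  ext j
  simp [proj, j.2]

theorem restr_mulVec {d : Fin n → ℝ} (hd : d ∈ P.H) :
    P.restr (P.A.mulVec d) = Matrix.toEuclideanLin P.B (P.restr d) := by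
  ext j
  exact (P.sum_free_eq (f := fun i => P.A j i * d i) (fun i hi => by simp [hd i hi])).symm

theorem restr_eq_zero {u : Fin n → ℝ} (hu : u ∈ P.H) : P.restr u = 0 ↔ u = 0 := by
  refine ⟨fun h => funext fun j => ?_, fun h => by rw [h, map_zero]⟩
  by_cases hj : j ∈ P.J0
  · exact hu j hj
  · exact congrArg (fun w : EuclideanSpace ℝ {j : Fin n // j ∉ P.J0} => w ⟨j, hj⟩) h

theorem exists_restr_eq (z : EuclideanSpace ℝ {j : Fin n // j ∉ P.J0}) :
    ∃ u ∈ P.H, P.restr u = z := by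
  refine ⟨fun j => if hj : j ∈ P.J0 then 0 else z ⟨j, hj⟩, fun j hj => by simp [hj], ?_⟩
  ext j
  simp [j.2]

theorem posSemidef_B (hA : P.A.PosSemidef) : P.B.PosSemidef := hA.submatrix _

/-- If `q` is bounded below on `H`, its gradients in the free variables lie in the range of the
Hessian. -/
theorem restr_grad_mem_range (hA : P.A.PosSemidef) (hb : P.EqBddBelow) {x : Fin n → ℝ}
    (hx : x ∈ P.H) :
    P.restr (P.A.mulVec x - P.b + P.c) ∈ LinearMap.range (Matrix.toEuclideanLin P.B) := by
  have hsym := Matrix.isSymmetric_toEuclideanLin_iff.2 (P.posSemidef_B hA).isHermitian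
  -- The range is the orthogonal complement of the kernel. Along a kernel direction `q` is affine,
  -- so boundedness forces zero slope.
  rw [← Submodule.orthogonal_orthogonal (LinearMap.range (Matrix.toEuclideanLin P.B)),
    hsym.orthogonal_range, Submodule.mem_orthogonal]
  intro z hz
  obtain ⟨u, hu, rfl⟩ := P.exists_restr_eq z
  obtain ⟨C, hC⟩ := hb
  have hcurv : u ⬝ᵥ P.A.mulVec u = 0 := by
    rw [dotProduct_comm, ← P.inner_restr _ hu, P.restr_mulVec hu, LinearMap.mem_ker.1 hz,
      inner_zero_left]
  rw [real_inner_comm, P.inner_restr _ hu]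
  by_contra hs
  set s := (P.A.mulVec x - P.b + P.c) ⬝ᵥ u
  -- The step length is chosen so that `q` takes the value `C - 1` there.
  have hmem : x + ((C - P.q x - 1) / s) • u ∈ P.H := fun j hj => by simp [hx j hj, hu j hj]
  have h := hC ⟨_, hmem, rfl⟩
  rw [P.q_add_smul hA, hcurv, div_mul_cancel₀ _ hs] at h
  linarith

/-- If the projected gradient vanishes at a point of `H`, then that point minimizes `q` on `H`. -/
theorem eqBddBelow_of_proj_grad_eq_zero (hA : P.A.PosSemidef) {x : Fin n → ℝ} (hx : x ∈ P.H)
    (h0 : P.proj (P.A.mulVec x - P.b + P.c) = 0) : P.EqBddBelow := by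
  refine ⟨P.q x, ?_⟩
  rintro _ ⟨y, hy, rfl⟩
  have hd : y - x ∈ P.H := fun j hj => by simp [hx j hj, hy j hj]
  have h := P.q_add_smul hA x (y - x) 1
  rw [← P.proj_dotProduct hd, h0, zero_dotProduct, one_smul, add_sub_cancel] at h
  have := P.dotProduct_mulVec_nonneg hA (y - x)
  linarith

/-- `alphaTC` is only a supremum, so the endpoint needs an argument: a sign constraint violated at
`a` already caps all feasible steps strictly below `a`. -/
theorem add_smul_mem_Ω {x d : Fin n → ℝ} (hx : x ∈ P.Ω) (hd : d ∈ P.H) {a : ℝ} (ha : 0 ≤ a)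
    (h : (a : EReal) ≤ P.alphaTC x d) : x + a • d ∈ P.Ω := by
  have key (t s : ℝ) (ht : 0 ≤ t) (hts : ∀ β : ℝ, x + β • d ∈ P.Ω → 0 ≤ t + β * s) :
      0 ≤ t + a * s := by
    by_contra! hneg
    have hs : s < 0 := by
      by_contra! hs
      nlinarith [mul_nonneg ha hs]
    have hlt : t / -s < a := by rw [div_lt_iff₀ (by linarith)]; linarith
    have hle : P.alphaTC x d ≤ ((t / -s : ℝ) : EReal) := by
      refine sSup_le ?_
      rintro _ ⟨β, hβ, rfl⟩
      rw [EReal.coe_le_coe_iff, le_div_iff₀ (by linarith)]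
      linarith [hts β hβ]
    exact absurd (EReal.coe_le_coe_iff.1 (h.trans hle)) (not_le.2 hlt)
  refine ⟨fun j hj => by simp [hx.1 j hj, hd j hj], fun j hj => ?_, fun j hj => ?_⟩
  · have := key (-x j) (-d j) (by linarith [hx.2.1 j hj]) fun β hβ => by
      have := hβ.2.1 j hj
      simp only [Pi.add_apply, Pi.smul_apply, smul_eq_mul] at this
      linarith
    simp only [Pi.add_apply, Pi.smul_apply, smul_eq_mul]
    linarith
  · exact key (x j) (d j) (hx.2.2 j hj) fun β hβ => hβ.2.2 j hj

theorem alphaTC_nonneg {x : Fin n → ℝ} (hx : x ∈ P.Ω) (d : Fin n → ℝ) : 0 ≤ P.alphaTC x d :=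
  le_sSup ⟨0, by simpa using hx, by simp⟩

theorem alphaCG_nonneg (hA : P.A.PosSemidef) (p d : Fin n → ℝ) : 0 ≤ P.alphaCG p d := by
  unfold alphaCG
  split_ifs
  · exact le_top
  · exact EReal.coe_nonneg.2 (div_nonneg (sq_nonneg _) (P.dotProduct_mulVec_nonneg hA d))

/-- A descent direction of zero curvature leaves the feasible region of a solvable problem. -/
theorem alphaTC_ne_top (hA : P.A.PosSemidef) (hsol : P.HasSolution) {x d : Fin n → ℝ}
    (hx : x ∈ P.Ω) (hd : d ∈ P.H) (hcurv : d ⬝ᵥ P.A.mulVec d = 0)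
    (hdesc : (P.A.mulVec x - P.b + P.c) ⬝ᵥ d < 0) : P.alphaTC x d ≠ ⊤ := by
  intro htop
  obtain ⟨y, -, hy⟩ := hsol
  set s := (P.A.mulVec x - P.b + P.c) ⬝ᵥ d
  -- This step would bring `q` down to `P.q y - 1`, below the minimum.
  have ha : 0 ≤ (P.q y - P.q x - 1) / s :=
    div_nonneg_of_nonpos (by linarith [hy x hx]) hdesc.le
  have h := hy _ (P.add_smul_mem_Ω hx hd ha (htop ▸ le_top))
  rw [P.q_add_smul hA, hcurv, div_mul_cancel₀ _ hdesc.ne] at h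
  linarith

/-! ### The loop as a truncated conjugate gradient run -/

/-- The iterate obtained by a full conjugate gradient step. -/
noncomputable def cgNext (s : State n) : State n :=
  let a := l2norm s.p ^ 2 / (s.d ⬝ᵥ P.A.mulVec s.d)
  let p' := P.proj (s.r + a • P.A.mulVec s.d)
  { x := s.x + a • s.d
    r := s.r + a • P.A.mulVec s.d
    p := p'
    d := -p' + (l2norm p' ^ 2 / l2norm s.p ^ 2) • s.d }

/-- A pass that is not truncated has `α = αᶜᵍ`; since `α` is finite, the curvature is then nonzero
and the step is a genuine conjugate gradient step. -/
theorem pass_cases (hA : P.A.PosSemidef) (ε : ℝ) {s : State n} (hp : s.p ≠ 0) (hx : s.x ∈ P.Ω)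
    (hd : s.d ∈ P.H)
    (htc : s.d ⬝ᵥ P.A.mulVec s.d = 0 → P.alphaTC s.x s.d ≠ ⊤) :
    (∃ y, P.pass ε s = Outcome.done y) ∨
      (P.pass ε s = Outcome.next (P.cgNext s) ∧ s.d ⬝ᵥ P.A.mulVec s.d ≠ 0 ∧
        ε < ‖(P.cgNext s).p‖ ∧ (P.cgNext s).x ∈ P.Ω) := by
  have hα0 : 0 ≤ P.alpha s.x s.p s.d := le_min (P.alphaCG_nonneg hA _ _) (P.alphaTC_nonneg hx _)
  have hbot : P.alpha s.x s.p s.d ≠ ⊥ := fun h => by simp [h] at hα0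
  have htop : P.alpha s.x s.p s.d ≠ ⊤ := by
    intro h
    obtain ⟨h1, h2⟩ := min_eq_top.1 h
    by_cases hc : s.d ⬝ᵥ P.A.mulVec s.d = 0
    · exact htc hc h2
    · rw [alphaCG, if_neg hc] at h1
      exact EReal.coe_ne_top _ h1
  by_cases hlt : P.alpha s.x s.p s.d < P.alphaCG s.p s.d
  · left
    refine ⟨s.x + (P.alpha s.x s.p s.d).toReal • s.d, ?_⟩
    simp only [pass, hp, htop, hbot, hlt, or_self, if_false, if_true]
  have heq : P.alpha s.x s.p s.d = P.alphaCG s.p s.d := le_antisymm (min_le_left _ _) (not_lt.1 hlt)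
  have hc : s.d ⬝ᵥ P.A.mulVec s.d ≠ 0 := by
    intro hc
    rw [heq, alphaCG, if_pos hc] at htop
    exact htop rfl
  have hcg : P.alphaCG s.p s.d =
      ((l2norm s.p ^ 2 / (s.d ⬝ᵥ P.A.mulVec s.d) : ℝ) : EReal) := by rw [alphaCG, if_neg hc]
  have hreal : (P.alpha s.x s.p s.d).toReal = l2norm s.p ^ 2 / (s.d ⬝ᵥ P.A.mulVec s.d) := by
    rw [heq, hcg, EReal.toReal_coe]
  by_cases hε : ‖(P.cgNext s).p‖ ≤ ε
  · left
    refine ⟨(P.cgNext s).x, ?_⟩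
    simp only [cgNext] at hε
    simp only [pass, hp, htop, hbot, hlt, or_self, if_false, hreal, hε, if_true, cgNext]
  · right
    refine ⟨?_, hc, not_le.1 hε, ?_⟩
    · simp only [cgNext] at hε
      simp only [pass, hp, htop, hbot, hlt, or_self, if_false, hreal, hε, cgNext]
    · refine P.add_smul_mem_Ω hx hd
        (div_nonneg (sq_nonneg _) (P.dotProduct_mulVec_nonneg hA _)) ?_
      rw [← hcg, ← heq]
      exact min_le_right _ _

/-- The iterates of the untruncated conjugate gradient method. -/
noncomputable def cgIter (x0 : Fin n → ℝ) : ℕ → State n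
  | 0 => P.init x0
  | k + 1 => P.cgNext (cgIter x0 k)

theorem cgIter_p_eq (x0 : Fin n → ℝ) (k : ℕ) :
    (P.cgIter x0 k).p = P.proj (P.cgIter x0 k).r := by
  cases k <;> rfl

theorem cgIter_p_mem (x0 : Fin n → ℝ) (k : ℕ) : (P.cgIter x0 k).p ∈ P.H := by
  rw [cgIter_p_eq]; exact P.proj_mem _

theorem cgIter_r_eq (x0 : Fin n → ℝ) (k : ℕ) :
    (P.cgIter x0 k).r = P.A.mulVec (P.cgIter x0 k).x - P.b + P.c := by
  induction k with
  | zero => rfl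
  | succ k ih =>
    simp only [cgIter, cgNext, ih, Matrix.mulVec_add, Matrix.mulVec_smul]
    abel

theorem cgIter_d_mem (x0 : Fin n → ℝ) (k : ℕ) : (P.cgIter x0 k).d ∈ P.H := by
  induction k with
  | zero => intro j hj; simp [cgIter, init, proj, hj]
  | succ k ih =>
    intro j hj
    simp [cgIter, cgNext, proj, hj, ih j hj]

/-- The method started from `x0` performs `m` full steps without stopping. -/
structure FullSteps (ε : ℝ) (x0 : Fin n → ℝ) (m : ℕ) : Prop where
  pass_eq : ∀ k < m, P.pass ε (P.cgIter x0 k) = Outcome.next (P.cgIter x0 (k + 1))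
  curvature_ne_zero : ∀ k < m, (P.cgIter x0 k).d ⬝ᵥ P.A.mulVec (P.cgIter x0 k).d ≠ 0
  lt_norm : ∀ k < m, ε < ‖(P.cgIter x0 (k + 1)).p‖
  mem : (P.cgIter x0 m).x ∈ P.Ω

namespace FullSteps

variable {P} {ε : ℝ} {x0 : Fin n → ℝ} {m : ℕ}

theorem p_ne_zero (h : P.FullSteps ε x0 m) (hε : 0 ≤ ε) (h0 : (P.init x0).p ≠ 0) {k : ℕ}
    (hk : k ≤ m) : (P.cgIter x0 k).p ≠ 0 := by
  rcases k with _ | k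
  · exact h0
  · exact norm_pos_iff.1 (hε.trans_lt (h.lt_norm k hk))

/-- Restriction does not see `proj`, and on `H` it carries `A` to `P.B`. The recurrences therefore
hold by construction; the full steps supply the nonvanishing denominators. -/
theorem isCGRun (h : P.FullSteps ε x0 m) (hε : 0 ≤ ε) (h0 : (P.init x0).p ≠ 0) :
    IsCGRun (Matrix.toEuclideanLin P.B) (fun k => P.restr (P.cgIter x0 k).p)
      (fun k => P.restr (P.cgIter x0 k).d) m := by
  have hin (k : ℕ) : inner ℝ (P.restr (P.cgIter x0 k).d)
      (Matrix.toEuclideanLin P.B (P.restr (P.cgIter x0 k).d)) =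
        (P.cgIter x0 k).d ⬝ᵥ P.A.mulVec (P.cgIter x0 k).d := by
    rw [← P.restr_mulVec (P.cgIter_d_mem x0 k), real_inner_comm,
      P.inner_restr _ (P.cgIter_d_mem x0 k), dotProduct_comm]
  refine ⟨map_neg _ _, fun k _ => ?_, fun k _ => ?_, fun k hk => ?_, fun k hk => ?_⟩
  · rw [hin, P.norm_restr (P.cgIter_p_mem x0 k), ← P.restr_mulVec (P.cgIter_d_mem x0 k),
      P.cgIter_p_eq x0 (k + 1), P.restr_proj, ← map_smul, P.cgIter_p_eq x0 k,
      P.restr_proj, ← map_add, ← P.cgIter_p_eq x0 k]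
    rfl
  · rw [P.norm_restr (P.cgIter_p_mem x0 k), P.norm_restr (P.cgIter_p_mem x0 (k + 1)), ← map_smul,
      ← map_neg, ← map_add]
    rfl
  · exact fun h' => h.p_ne_zero hε h0 hk.le ((P.restr_eq_zero (P.cgIter_p_mem x0 k)).1 h')
  · rw [hin]; exact h.curvature_ne_zero k hk

/-- `inner_v_g` makes `d` a descent direction, so solvability excludes an infinite step when the
curvature vanishes. -/
theorem returns_or_succ (hA : P.A.PosSemidef) (hsol : P.HasSolution) (hε : 0 ≤ ε)
    (h0 : (P.init x0).p ≠ 0) (h : P.FullSteps ε x0 m) :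
    (∃ y, P.pass ε (P.cgIter x0 m) = Outcome.done y) ∨ P.FullSteps ε x0 (m + 1) := by
  have hd := P.cgIter_d_mem x0 m
  have hp := h.p_ne_zero hε h0 le_rfl
  have hpH := P.cgIter_p_mem x0 m
  have hpass := P.pass_cases hA ε hp h.mem hd fun hc => by
    refine P.alphaTC_ne_top hA hsol h.mem hd hc ?_
    have hvg := (h.isCGRun hε h0).inner_v_g le_rfl
    rw [real_inner_comm, P.inner_restr _ hd] at hvg
    rw [← P.proj_dotProduct hd, ← P.cgIter_r_eq, ← P.cgIter_p_eq, hvg]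
    have : 0 < ‖P.restr (P.cgIter x0 m).p‖ :=
      norm_pos_iff.2 fun h' => hp ((P.restr_eq_zero hpH).1 h')
    exact neg_neg_of_pos (pow_pos this 2)
  refine hpass.imp id fun ⟨h1, h2, h3, h4⟩ => ⟨fun k hk => ?_, fun k hk => ?_, fun k hk => ?_, h4⟩
  all_goals rcases (Nat.lt_succ_iff.1 hk).lt_or_eq with hlt | rfl
  · exact h.pass_eq k hlt
  · exact h1
  · exact h.curvature_ne_zero k hlt
  · exact h2
  · exact h.lt_norm k hlt
  · exact h3

/-- `V` is kept general: it will be the range of `P.B`, that range plus a line, or the whole space.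
-/
theorem length_lt (hA : P.A.PosSemidef) (hε : 0 ≤ ε) (h0 : (P.init x0).p ≠ 0)
    (h : P.FullSteps ε x0 m)
    {V : Submodule ℝ (EuclideanSpace ℝ {j : Fin n // j ∉ P.J0})}
    (hV : LinearMap.range (Matrix.toEuclideanLin P.B) ≤ V) (hp : P.restr (P.init x0).p ∈ V) :
    m + 1 ≤ Module.finrank ℝ V :=
  (h.isCGRun hε h0).length_lt_finrank
    (Matrix.isSymmetric_toEuclideanLin_iff.2 (P.posSemidef_B hA).isHermitian)
    (fun h' => h.p_ne_zero hε h0 le_rfl ((P.restr_eq_zero (P.cgIter_p_mem x0 m)).1 h')) hV hp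

end FullSteps

theorem returns_of_pass_eq {ε : ℝ} {y : Fin n → ℝ} {m : ℕ} {f : ℕ → State n}
    (h : ∀ k < m, P.pass ε (f k) = Outcome.next (f (k + 1)))
    (hm : P.pass ε (f m) = Outcome.done y) : P.Returns ε (f 0) (m + 1) y := by
  induction m generalizing f with
  | zero => exact .done hm
  | succ m ih =>
    exact .next (h 0 (by omega)) (ih (f := fun k => f (k + 1)) (fun k hk => h (k + 1) (by omega)) hm)

/-- The method stops after finitely many full steps. -/
theorem exists_returns (hA : P.A.PosSemidef) (hsol : P.HasSolution) {x0 : Fin n → ℝ}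
    (hx0 : x0 ∈ P.Ω) {ε : ℝ} (hε : 0 ≤ ε) (h0 : (P.init x0).p ≠ 0) :
    ∃ m y, P.FullSteps ε x0 m ∧ P.Returns ε (P.init x0) (m + 1) y := by
  by_contra! hno
  have hall (m : ℕ) : P.FullSteps ε x0 m := by
    induction m with
    | zero => exact ⟨by simp, by simp, by simp, hx0⟩
    | succ m ih =>
      refine (ih.returns_or_succ hA hsol hε h0).resolve_left ?_
      rintro ⟨y, hy⟩
      exact hno m y ih (P.returns_of_pass_eq (f := P.cgIter x0) ih.pass_eq hy)
  have := (hall (Module.finrank ℝ (⊤ : Submodule ℝ (EuclideanSpace ℝ {j : Fin n // j ∉ P.J0})))).length_lt hA hε h0 (V := ⊤) le_top Submodule.mem_top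
  exact absurd this (Nat.not_succ_le_self _)

end FaceQP

end TPCG

/-! ### The two iteration bounds -/

theorem mainTheorem9 (n : ℕ) (P : TPCG.FaceQP n) (hA : P.A.PosSemidef) (hJ : P.IsPartition)
    (hsol : P.HasSolution) (x0 : Fin n → ℝ) (hx0 : x0 ∈ P.Ω) (ε : ℝ) (hε : 0 ≤ ε) :
    (P.EqBddBelow → (P.init x0).p ≠ 0 →
      ∃ (N : ℕ) (y : Fin n → ℝ), P.Returns ε (P.init x0) N y ∧
        ((N : ℤ) : WithTop ℤ) ≤
          min (max 1 (TPCG.bigM ε (TPCG.kappa P.B) (TPCG.l2norm (P.init x0).p)))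
            ((P.B.rank : ℤ) : WithTop ℤ)) ∧
    (¬ P.EqBddBelow →
      ∃ (N : ℕ) (y : Fin n → ℝ), P.Returns ε (P.init x0) N y ∧ N ≤ P.B.rank + 1) := by
  have hx0H : x0 ∈ P.H := P.Ω_subset_H hx0
  refine ⟨fun hb h0 => ?_, fun hb => ?_⟩
  · obtain ⟨m, y, hm, hy⟩ := P.exists_returns hA hsol hx0 hε h0
    refine ⟨m + 1, y, hy, le_min ?_ ?_⟩
    -- Stopping in the first pass says nothing about `bigM`; this is what the maximum with 1 covers.
    · rcases eq_or_ne m 0 with rfl | hm0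
      · exact le_max_left _ _
      · refine le_max_of_le_right ?_
        have hp0 := P.cgIter_p_mem x0 0
        have hpm := P.cgIter_p_mem x0 m
        have hg0 : P.restr (P.cgIter x0 0).p ≠ 0 := fun h => h0 ((P.restr_eq_zero hp0).1 h)
        have hrange : P.restr (P.cgIter x0 0).p ∈
            LinearMap.range (Matrix.toEuclideanLin P.B) := by
          rw [P.cgIter_p_eq, P.restr_proj]
          exact P.restr_grad_mem_range hA hb hx0H
        obtain ⟨hκ, hbound⟩ :=
          (hm.isCGRun hε h0).norm_sq_g_le_kappa (P.posSemidef_B hA) hrange hg0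
        have hbm := hbound m le_rfl
        rw [P.norm_restr hp0, P.norm_restr hpm] at hbm
        refine TPCG.succ_le_bigM hε hκ ?_ hm0 ?_ hbm
        · have := norm_pos_iff.2 hg0
          rwa [P.norm_restr hp0] at this
        · obtain ⟨k, rfl⟩ := Nat.exists_eq_succ_of_ne_zero hm0
          -- The stopping test uses the max norm, which the Euclidean norm dominates.
          refine (hm.lt_norm k (Nat.lt_succ_self k)).trans_le ?_
          rw [TPCG.l2norm, pi_norm_le_iff_of_nonneg (norm_nonneg _)]
          exact fun j => PiLp.norm_apply_le (WithLp.toLp 2 (P.cgIter x0 (k + 1)).p) j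
    · rw [WithTop.coe_le_coe, Nat.cast_le, Matrix.rank_eq_finrank_range_toEuclideanLin]
      refine hm.length_lt hA hε h0 le_rfl ?_
      change P.restr (P.proj _) ∈ _
      rw [P.restr_proj]
      exact P.restr_grad_mem_range hA hb hx0H
  · have h0 : (P.init x0).p ≠ 0 := fun h => hb (P.eqBddBelow_of_proj_grad_eq_zero hA hx0H h)
    obtain ⟨m, y, hm, hy⟩ := P.exists_returns hA hsol hx0 hε h0
    refine ⟨m + 1, y, hy, ?_⟩
    -- The initial gradient may lie outside the range; adjoining its span costs the extra 1.
    have hlen := hm.length_lt hA hε h0 (V := LinearMap.range (Matrix.toEuclideanLin P.B) ⊔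
      Submodule.span ℝ {P.restr (P.init x0).p}) le_sup_left
      (Submodule.mem_sup_right (Submodule.mem_span_singleton_self _))
    refine hlen.trans ((Submodule.finrank_add_le_finrank_add_finrank _ _).trans ?_)
    rw [Matrix.rank_eq_finrank_range_toEuclideanLin]
    exact Nat.add_le_add_left (finrank_span_singleton
      fun h => h0 ((P.restr_eq_zero (P.cgIter_p_mem x0 0)).1 h)).le _
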